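/- Let $Z$ be a real or complex separable Banach space and let $A$ be a bounded linear operator on $Z$. Suppose that there is a sequence $(z_n)_{n\in\mathbb Z}$ of vectors of $Z$ with $Az_n=z_{n+1}$ for every $n\in\mathbb Z$ (we write $A^nz_0$ for $z_n$, for every $n\in\mathbb Z$; $A$ need not be invertible) such that (a) $z_0$ is bicyclic, i.e. the closed linear span of $\{A^{-n}z_0 : n\in\mathbb Z\}$ is $Z$; (b) there is a finite set $F\subset\mathbb Z$ such that the closed linear span of $\{A^{-n}z_0 : n\in\mathbb Z\setminus F\}$ is not $Z$; (c) the series $\sum_{n\in\mathbb Z}A^{-n}z_0$ converges unconditionally in $Z$. Then $A$ is universal for invertible ergodic systems: for every nonatomic standard Borel probability space $(X,\mathcal B,\mu)$ (a standard Lebesgue probability space) and every ergodic measure-preserving transformation $T$ of $(X,\mathcal B,\mu)$ which is invertible (i.e. has a measure-preserving inverse, up to null sets), there is an $A$-invariant Borel probability measure $\nu$ on $Z$ with full support (every non-empty open set has positive $\nu$-measure) such that the systems $(X,\mathcal B,\mu;T)$ and $(Z,\mathcal B_Z,\nu;A)$ are isomorphic, where $\mathcal B_Z$ is the Borel $\sigma$-algebra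 of $Z$. Here isomorphic means: there are measurable sets $M\subseteq X$ and $N\subseteq Z$ of full measure with $T(M)\subseteq M$ and $A(N)\subseteq N$, and a bijection $\Phi:M\to N$, measurable and measure-preserving together with its inverse, such that $\Phi(Tx)=A\Phi(x)$ for every $x\in M$. Moreover, for each such system the measure $\nu$ can be chosen so that in addition $\int_Z\|z\|^2\,d\nu(z)<\infty$. -/

import Mathlib

open MeasureTheory Set

universe u v w

/-- The transformation `T` of `(X, μ)` is invertible as a measure-preserving transformation:
it has a measure-preserving inverse, up to null sets. (This holds in particular when `T` is a
bijection which preserves `μ` together with its inverse.) -/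
def InvertibleModNull {X : Type u} [MeasurableSpace X] (T : X → X) (μ : Measure X) : Prop :=
  MeasurePreserving T μ μ ∧
    ∃ S : X → X, MeasurePreserving S μ μ ∧ (∀ᵐ x ∂μ, S (T x) = x) ∧ (∀ᵐ x ∂μ, T (S x) = x)

/-- Isomorphism of the measure-preserving systems `(X, μ; T)` and `(Y, ν; S)`: there are measurable
sets `M ⊆ X` and `N ⊆ Y` of full measure, with `T M ⊆ M` and `S N ⊆ N`, and a bimeasurable
measure-preserving bijection `Φ : M → N` such that `Φ (T x) = S (Φ x)` for every `x ∈ M`. -/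
def IsomorphicSystems {X : Type u} [MeasurableSpace X] {Y : Type v} [MeasurableSpace Y]
    (T : X → X) (μ : Measure X) (S : Y → Y) (ν : Measure Y) : Prop :=
  ∃ (M : Set X) (N : Set Y),
    MeasurableSet M ∧ MeasurableSet N ∧ μ Mᶜ = 0 ∧ ν Nᶜ = 0 ∧ MapsTo S N N ∧
    ∃ (hT : MapsTo T M M) (Φ : M ≃ᵐ N),
      MeasurePreserving Φ (μ.comap (Subtype.val : M → X)) (ν.comap (Subtype.val : N → Y)) ∧
      ∀ x : M, (Φ ⟨T x, hT x.2⟩ : Y) = S (Φ x)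

/-- `ν` is an `A`-invariant Borel probability measure on `Z` with full support such that
`(X, μ; T)` and `(Z, ν; A)` are isomorphic: a linear model, by the operator `A`, of the system
`(X, μ; T)`. -/
structure IsLinearModel {𝕜 : Type w} [RCLike 𝕜] {Z : Type v} [NormedAddCommGroup Z]
    [NormedSpace 𝕜 Z] [MeasurableSpace Z] (A : Z →L[𝕜] Z)
    {X : Type u} [MeasurableSpace X] (T : X → X) (μ : Measure X) (ν : Measure Z) : Prop where
  isProbabilityMeasure : IsProbabilityMeasure ν
  invariant : MeasurePreserving A ν ν
  fullSupport : ∀ U : Set Z, IsOpen U → U.Nonempty → 0 < ν U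
  isomorphic : IsomorphicSystems T μ A ν

/-- `A` is universal for invertible ergodic systems: every invertible ergodic system on a standard
Lebesgue (that is, standard Borel and nonatomic) probability space has a linear model by `A`. -/
def UniversalForInvertibleErgodic {𝕜 : Type w} [RCLike 𝕜] {Z : Type v} [NormedAddCommGroup Z]
    [NormedSpace 𝕜 Z] [MeasurableSpace Z] (A : Z →L[𝕜] Z) : Prop :=
  ∀ (X : Type u) [MeasurableSpace X] [StandardBorelSpace X] (μ : Measure X)
    [IsProbabilityMeasure μ] [NullSingletonClass μ] (T : X → X),
    Ergodic T μ → InvertibleModNull T μ → ∃ ν : Measure Z, IsLinearModel A T μ ν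

/-- The same as `UniversalForInvertibleErgodic`, with the additional requirement that the
measure `ν` has a moment of order two: `∫ ‖z‖² dν(z) < ∞`. -/
def TwoUniversalForInvertibleErgodic {𝕜 : Type w} [RCLike 𝕜] {Z : Type v} [NormedAddCommGroup Z]
    [NormedSpace 𝕜 Z] [MeasurableSpace Z] (A : Z →L[𝕜] Z) : Prop :=
  ∀ (X : Type u) [MeasurableSpace X] [StandardBorelSpace X] (μ : Measure X)
    [IsProbabilityMeasure μ] [NullSingletonClass μ] (T : X → X),
    Ergodic T μ → InvertibleModNull T μ →
      ∃ ν : Measure Z, IsLinearModel A T μ ν ∧ ∫⁻ z, ‖z‖ₑ ^ 2 ∂ν < ⊤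

/-!
The isomorphism onto a linear model is found among the limits of orbit sums. Put `y n = z (-n)`, so
that `A (y (n + 1)) = y n`. For a scalar simple function `h` on `X`, the orbit sum
`Φ_h x = ∑ n, h (T ^ n x) • y n` converges, since an unconditionally convergent series stays
convergent under bounded multipliers, and `Φ_h ∘ T = A ∘ Φ_h`. It belongs to `L²(X; Z)`; let `Y` be
the closure of all the `Φ_h` in `L²(X; Z)`. Every `f` in `Y` satisfies `f ∘ T = A ∘ f` almost
everywhere. By Baire's theorem, generic members of `Y` have two more properties.

* Full support. The condition that `f` takes values in a given open set `U` with positive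
  probability is open. It is dense: tails of the series are small uniformly over bounded multipliers,
  so changing `h` on a thin tower `⋃ n, T ^ n D` (where `|n|` is bounded) to the coefficients of a
  linear combination of the `y n` inside `U` brings `Φ_h` into `U` on the base `D`, while an orbit
  sum of a bounded function with small support is small in `L²`
  (`exists_edist_orbitSumLp_lt_measure_preimage_ne_zero`). Only the existence of small sets disjoint
  from their first translates is needed here, and this follows from aperiodicity.

* Injectivity. By hypothesis (b) some functional `φ ≠ 0` vanishes on `y n` for `n` outside a finite
  set, so that `φ ∘ Φ_h` takes finitely many values. For a set `E`, let
  `s_E x = ∑ n, φ (y n) * 1_E (T ^ n x)`, which is `φ ∘ Φ_h` for `h = 1_E`. That `s_E` is, up to a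
  given error, a continuous function of `f` is an open condition, and it is dense since `s_E` can be
  read off from `Φ_h + α • Φ_k`, where `k = 1_E`, for all but finitely many scalars `α`
  (`exists_dist_orbitSumLp_lt_mem_approxFactors`). Hence for generic `f`, off a null set, `f x`
  determines `s_E x` for all `E` in a countable basis of a Polish topology on `X`. These numbers
  determine the finite combination `∑ n, φ (y n) δ_(T ^ n x)` of point masses, and thus `x`, since
  a finite nonempty set of integers is not invariant under a nonzero translation
  (`eq_of_sum_indicator_eq`).

The image of `μ` under such an `f` is the required measure (`IsomorphicSystems.of_ae_injOn`), and its
second moment is finite because `f` is in `L²`.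
-/

/-! ### Bounded multipliers of unconditionally convergent series -/

section Multipliers

open Filter Topology

variable {𝕜 : Type*} [RCLike 𝕜] {E : Type*} [NormedAddCommGroup E] [NormedSpace 𝕜 E] {ι : Type*}

lemma sum_abs_le_of_norm_sum_subset_le {t : Finset ι} {y : ι → E} {δ : ℝ}
    (h : ∀ t' ⊆ t, ‖∑ n ∈ t', y n‖ ≤ δ) (r : E →+ ℝ) (hr : ∀ v, |r v| ≤ ‖v‖) :
    ∑ n ∈ t, |r (y n)| ≤ 2 * δ := by
  classical
  rw [← Finset.sum_filter_add_sum_filter_not t (fun n => 0 ≤ r (y n))]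
  have h1 : ∑ n ∈ t with 0 ≤ r (y n), |r (y n)| ≤ δ := by
    have h2 : ∑ n ∈ t with 0 ≤ r (y n), |r (y n)| = r (∑ n ∈ t with 0 ≤ r (y n), y n) := by
      rw [map_sum]
      exact Finset.sum_congr rfl fun n hn => abs_of_nonneg (Finset.mem_filter.1 hn).2
    rw [h2]
    exact (le_abs_self _).trans ((hr _).trans (h _ (Finset.filter_subset _ _)))
  have h3 : ∑ n ∈ t with ¬ 0 ≤ r (y n), |r (y n)| ≤ δ := by
    have h2 : ∑ n ∈ t with ¬ 0 ≤ r (y n), |r (y n)| = -r (∑ n ∈ t with ¬ 0 ≤ r (y n), y n) := by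
      rw [map_sum, ← Finset.sum_neg_distrib]
      exact Finset.sum_congr rfl fun n hn =>
        abs_of_neg (not_le.1 (Finset.mem_filter.1 hn).2)
    rw [h2]
    exact (neg_le_abs _).trans ((hr _).trans (h _ (Finset.filter_subset _ _)))
  linarith

/-- Multiplying the terms of a finite sum by scalars of modulus at most `M` costs a factor of at
most `4 * M`, relative to the largest subsum. -/
lemma norm_sum_smul_le {t : Finset ι} {y : ι → E} {δ M : ℝ}
    (h : ∀ t' ⊆ t, ‖∑ n ∈ t', y n‖ ≤ δ) (b : ι → 𝕜) (hb : ∀ n, ‖b n‖ ≤ M) (hM : 0 ≤ M) :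
    ‖∑ n ∈ t, b n • y n‖ ≤ 4 * M * δ := by
  obtain ⟨g, hg1, hg⟩ := exists_dual_vector'' 𝕜 (∑ n ∈ t, b n • y n)
  have hgv : ∀ v, ‖g v‖ ≤ ‖v‖ := fun v => by
    simpa using g.le_of_opNorm_le hg1 v
  have hre := sum_abs_le_of_norm_sum_subset_le h
    ((RCLike.re : 𝕜 →+ ℝ).comp (g : E →ₗ[𝕜] 𝕜).toAddMonoidHom)
    (fun v => (RCLike.abs_re_le_norm (g v)).trans (hgv v))
  have him := sum_abs_le_of_norm_sum_subset_le h
    ((RCLike.im : 𝕜 →+ ℝ).comp (g : E →ₗ[𝕜] 𝕜).toAddMonoidHom)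
    (fun v => (RCLike.abs_im_le_norm (g v)).trans (hgv v))
  simp only [AddMonoidHom.comp_apply, LinearMap.toAddMonoidHom_coe,
    ContinuousLinearMap.coe_coe] at hre him
  calc ‖∑ n ∈ t, b n • y n‖ = ‖g (∑ n ∈ t, b n • y n)‖ := by rw [hg]; simp
    _ = ‖∑ n ∈ t, b n * g (y n)‖ := by simp [map_sum]
    _ ≤ ∑ n ∈ t, M * (|RCLike.re (g (y n))| + |RCLike.im (g (y n))|) := by
        refine norm_sum_le_of_le _ fun n _ => ?_
        rw [norm_mul]
        refine mul_le_mul (hb n) ?_ (norm_nonneg _) hM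
        rw [← sq_le_sq₀ (norm_nonneg _) (by positivity), RCLike.norm_sq_eq_def, add_sq, sq_abs,
          sq_abs]
        nlinarith [abs_nonneg (RCLike.re (g (y n))), abs_nonneg (RCLike.im (g (y n))),
          mul_nonneg (abs_nonneg (RCLike.re (g (y n)))) (abs_nonneg (RCLike.im (g (y n))))]
    _ = M * (∑ n ∈ t, |RCLike.re (g (y n))| + ∑ n ∈ t, |RCLike.im (g (y n))|) := by
        rw [← Finset.mul_sum, Finset.sum_add_distrib]
    _ ≤ M * (2 * δ + 2 * δ) := by gcongr
    _ = 4 * M * δ := by ring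

variable [CompleteSpace E]

lemma Summable.smul_of_norm_le {y : ι → E} (hy : Summable y) {b : ι → 𝕜} {M : ℝ}
    (hb : ∀ n, ‖b n‖ ≤ M) : Summable fun n => b n • y n := by
  rcases isEmpty_or_nonempty ι with hι | ⟨⟨i⟩⟩
  · exact Summable.of_finite
  have hM : 0 ≤ M := (norm_nonneg _).trans (hb i)
  rw [summable_iff_vanishing_norm] at hy ⊢
  intro ε hε
  obtain ⟨s, hs⟩ := hy (ε / (4 * M + 1)) (by positivity)
  refine ⟨s, fun t ht => ?_⟩
  refine (norm_sum_smul_le (fun t' ht' => (hs t' (ht.mono_left ht')).le) b hb hM).trans_lt ?_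
  rw [mul_div_assoc', div_lt_iff₀ (by positivity)]
  nlinarith

/-- The tails of an unconditionally convergent series are small, uniformly over all choices of
multipliers bounded by `M`. -/
lemma Summable.exists_finset_norm_tsum_smul_le {y : ι → E} (hy : Summable y) (M : ℝ) {ε : ℝ}
    (hε : 0 < ε) :
    ∃ s : Finset ι, ∀ b : ι → 𝕜, (∀ n, ‖b n‖ ≤ M) → (∀ n ∈ s, b n = 0) →
      ‖∑' n, b n • y n‖ ≤ ε := by
  classical
  rcases lt_or_ge M 0 with hM | hM
  · refine ⟨∅, fun b hb _ => ?_⟩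
    rcases isEmpty_or_nonempty ι with hι | ⟨⟨i⟩⟩
    · simpa using hε.le
    · exact absurd ((norm_nonneg _).trans (hb i)) (not_le.2 hM)
  obtain ⟨s, hs⟩ := summable_iff_vanishing_norm.1 hy (ε / (4 * M + 1)) (by positivity)
  refine ⟨s, fun b hb hbs => ?_⟩
  refine le_of_tendsto ((hy.smul_of_norm_le hb).hasSum.norm) (Eventually.of_forall fun t => ?_)
  have h1 : ∑ n ∈ t, b n • y n = ∑ n ∈ t \ s, b n • y n := by
    refine (Finset.sum_subset Finset.sdiff_subset fun n hn hn' => ?_).symm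
    have : n ∈ s := by simpa [hn] using hn'
    simp [hbs n this]
  rw [h1]
  refine (norm_sum_smul_le (fun t' ht' =>
    (hs t' (Finset.sdiff_disjoint.mono_left ht')).le) b hb hM).trans ?_
  rw [mul_div_assoc', div_le_iff₀ (by positivity)]
  nlinarith

lemma Summable.exists_norm_tsum_smul_le {y : ι → E} (hy : Summable y) (M : ℝ) :
    ∃ C : ℝ, 0 ≤ C ∧ ∀ b : ι → 𝕜, (∀ n, ‖b n‖ ≤ M) → ‖∑' n, b n • y n‖ ≤ C := by
  classical
  obtain ⟨s, hs⟩ := hy.exists_finset_norm_tsum_smul_le (𝕜 := 𝕜) |M| one_pos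
  refine ⟨∑ n ∈ s, |M| * ‖y n‖ + 1, by positivity, fun b hb => ?_⟩
  have hbM : ∀ n, ‖b n‖ ≤ |M| := fun n => (hb n).trans (le_abs_self M)
  set b' : ι → 𝕜 := fun n => if n ∈ s then 0 else b n with hb'
  have hb'M : ∀ n, ‖b' n‖ ≤ |M| := fun n => by
    by_cases hn : n ∈ s <;> simp [hb', hn, hbM]
  have hsum := (hasSum_sum_of_ne_finset_zero (s := s)
    (f := fun n => (if n ∈ s then b n else 0) • y n) (by intro n hn; simp [hn])).add
    (hy.smul_of_norm_le hb'M).hasSum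
  have h2 : ∑' n, b n • y n = ∑ n ∈ s, b n • y n + ∑' n, b' n • y n := by
    have h3 : ∑ n ∈ s, b n • y n = ∑ n ∈ s, (if n ∈ s then b n else 0) • y n :=
      Finset.sum_congr rfl fun n hn => by rw [if_pos hn]
    rw [h3, ← hsum.tsum_eq]
    refine tsum_congr fun n => ?_
    by_cases hn : n ∈ s <;> simp [hb', hn]
  rw [h2]
  refine (norm_add_le _ _).trans (add_le_add (norm_sum_le_of_le _ fun n _ => ?_)
    (hs b' hb'M fun n hn => by simp [hb', hn]))
  rw [norm_smul]
  gcongr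
  exact hbM n

end Multipliers

/-! ### Ergodic transformations of nonatomic spaces -/

section Dynamics

open Filter Topology TopologicalSpace

/-- A transformation which is invertible up to null sets agrees, on a set of full measure, with an
everywhere defined measurable bijection. -/
lemma InvertibleModNull.exists_measurableEquiv {X : Type*} [MeasurableSpace X]
    [StandardBorelSpace X] {μ : Measure X} {T : X → X} (hT : InvertibleModNull T μ) :
    ∃ e : X ≃ᵐ X, e =ᵐ[μ] T := by
  classical
  obtain ⟨hT, S, hS, hST, hTS⟩ := hT
  -- the set of points at which `S` inverts `T` along all words in the letters `S` and `T`
  let act : List Bool → X → X := fun w x => w.foldl (fun x b => if b then T x else S x) x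
  have hact : ∀ w, MeasurePreserving (act w) μ μ := by
    intro w
    induction w with
    | nil => exact MeasurePreserving.id μ
    | cons b w ih =>
      cases b
      · exact ih.comp hS
      · exact ih.comp hT
  let X₀ : Set X := ⋂ w, (act w) ⁻¹' {x | S (T x) = x ∧ T (S x) = x}
  have hX₀ : MeasurableSet X₀ := by
    refine MeasurableSet.iInter fun w => (hact w).measurable ?_
    exact (measurableSet_eq_fun (hS.measurable.comp hT.measurable) measurable_id).inter
      (measurableSet_eq_fun (hT.measurable.comp hS.measurable) measurable_id)
  have hfull : ∀ᵐ x ∂μ, x ∈ X₀ := by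
    simp only [X₀, mem_iInter]
    refine ae_all_iff.2 fun w => (hact w).quasiMeasurePreserving.ae
      (p := fun x => S (T x) = x ∧ T (S x) = x) ?_
    filter_upwards [hST, hTS] with x h1 h2 using ⟨h1, h2⟩
  have hTX : ∀ x ∈ X₀, T x ∈ X₀ := fun x hx => mem_iInter.2 fun w => mem_iInter.1 hx (true :: w)
  have hSX : ∀ x ∈ X₀, S x ∈ X₀ := fun x hx => mem_iInter.2 fun w => mem_iInter.1 hx (false :: w)
  have hSTx : ∀ x ∈ X₀, S (T x) = x := fun x hx => (mem_iInter.1 hx []).1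
  have hTSx : ∀ x ∈ X₀, T (S x) = x := fun x hx => (mem_iInter.1 hx []).2
  refine ⟨⟨⟨fun x => if x ∈ X₀ then T x else x, fun x => if x ∈ X₀ then S x else x,
    fun x => ?_, fun x => ?_⟩, Measurable.ite hX₀ hT.measurable measurable_id,
    Measurable.ite hX₀ hS.measurable measurable_id⟩, ?_⟩
  · by_cases hx : x ∈ X₀ <;> simp [hx, hTX, hSTx]
  · by_cases hx : x ∈ X₀ <;> simp [hx, hSX, hTSx]
  · filter_upwards [hfull] with x hx
    simp [hx]

lemma Ergodic.congr_ae {X : Type*} [MeasurableSpace X] {μ : Measure X} {T T' : X → X}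
    (hT : Ergodic T μ) (hT' : Measurable T') (h : T' =ᵐ[μ] T) : Ergodic T' μ where
  measurable := hT'
  map_eq := by rw [Measure.map_congr h, hT.map_eq]
  aeconst_set s hs hs' := by
    refine hT.quasiErgodic.aeconst_set₀ hs.nullMeasurableSet ?_
    have h1 : T ⁻¹' s =ᵐ[μ] T' ⁻¹' s := by
      filter_upwards [h] with x hx
      exact congrArg (fun y => y ∈ s) hx.symm
    rwa [hs'] at h1

lemma MeasureTheory.MeasurePreserving.perm_zpow {X : Type*} [MeasurableSpace X] {μ : Measure X}
    {e : X ≃ᵐ X} (he : MeasurePreserving e μ μ) (n : ℤ) :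
    MeasurePreserving (((e.toEquiv : Equiv.Perm X) ^ n : Equiv.Perm X)) μ μ := by
  have hnat : ∀ (e : X ≃ᵐ X), MeasurePreserving e μ μ → ∀ n : ℕ,
      MeasurePreserving (((e.toEquiv : Equiv.Perm X) ^ n : Equiv.Perm X)) μ μ := by
    intro e he n
    rw [Equiv.Perm.coe_pow]
    exact he.iterate n
  obtain ⟨n, rfl | rfl⟩ := n.eq_nat_or_neg
  · exact_mod_cast hnat e he n
  · have h := hnat e.symm (he.symm e) n
    have h2 : (e.symm.toEquiv : Equiv.Perm X) = (e.toEquiv : Equiv.Perm X)⁻¹ := rfl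
    rw [h2, inv_pow] at h
    rw [zpow_neg, zpow_natCast]
    exact h

/-- A finite linear combination of point masses along a free orbit determines the point: if the
numbers `∑ n ∈ F, c n * 1_E (T ^ n x)` and `∑ n ∈ F, c n * 1_E (T ^ n y)` agree for all sets `E` of
a basis of the topology, then `x = y`. -/
lemma eq_of_sum_indicator_eq {X : Type*} [TopologicalSpace X] [PolishSpace X]
    {𝕜 : Type*} [Field 𝕜] {T : Equiv.Perm X} {F : Finset ℤ}
    (hF : F.Nonempty) {c : ℤ → 𝕜} (hc : ∀ n ∈ F, c n ≠ 0) {x y : X}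
    (hx : ∀ n : ℤ, n ≠ 0 → (T ^ n) x ≠ x)
    (h : ∀ E ∈ countableBasis X, ∑ n ∈ F, E.indicator (fun _ => c n) ((T ^ n) x) =
      ∑ n ∈ F, E.indicator (fun _ => c n) ((T ^ n) y)) : x = y := by
  classical
  have hinj : ∀ m n : ℤ, (T ^ m) x = (T ^ n) x → m = n := by
    intro m n hmn
    by_contra hne
    refine hx (-n + m) (by omega) ?_
    rw [zpow_add, Equiv.Perm.mul_apply, hmn, ← Equiv.Perm.mul_apply, ← zpow_add, neg_add_cancel,
      zpow_zero, Equiv.Perm.one_apply]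
  have key : ∀ n ∈ F, ∃ m ∈ F, (T ^ m) y = (T ^ n) x := by
    intro n hn
    by_contra! hne
    let P : Set X := (fun m : ℤ => (T ^ m) x) '' (F.erase n : Set ℤ) ∪
      (fun m : ℤ => (T ^ m) y) '' (F : Set ℤ)
    have hP : P.Finite := ((F.erase n).finite_toSet.image _).union (F.finite_toSet.image _)
    have hmem : (T ^ n) x ∈ Pᶜ := by
      rintro (⟨m, hm, hmn⟩ | ⟨m, hm, hmn⟩)
      · exact (Finset.mem_erase.1 hm).1 (hinj _ _ hmn)
      · exact hne m hm hmn
    obtain ⟨E, hE, hxE, hEsub⟩ :=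
      (isBasis_countableBasis X).exists_subset_of_mem_open hmem hP.isClosed.isOpen_compl
    have h1 := h E hE
    rw [Finset.sum_eq_single_of_mem n hn fun m hm hmn => indicator_of_notMem (fun hmE =>
        hEsub hmE (Or.inl ⟨m, Finset.mem_erase.2 ⟨hmn, hm⟩, rfl⟩)) _, indicator_of_mem hxE,
      Finset.sum_eq_zero fun m hm => indicator_of_notMem (fun hmE =>
        hEsub hmE (Or.inr ⟨m, hm, rfl⟩)) _] at h1
    exact hc n hn h1
  -- `y` is the translate of `x` by some `k`, and `F - k ⊆ F`, so that `k = 0`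
  obtain ⟨n₀, hn₀⟩ := hF
  obtain ⟨m₀, hm₀, hy⟩ := key n₀ hn₀
  have hyk : y = (T ^ (-m₀ + n₀)) x := by
    rw [zpow_add, Equiv.Perm.mul_apply, ← hy, ← Equiv.Perm.mul_apply, ← zpow_add, neg_add_cancel,
      zpow_zero, Equiv.Perm.one_apply]
  set k := -m₀ + n₀
  have hshift : ∀ n ∈ F, n - k ∈ F := by
    intro n hn
    obtain ⟨m, hm, hmn⟩ := key n hn
    rw [hyk, ← Equiv.Perm.mul_apply, ← zpow_add] at hmn
    have := hinj _ _ hmn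
    rwa [← this, add_sub_cancel_right]
  have hk : k = 0 := by
    have h1 := F.min'_le _ (hshift _ (F.min'_mem ⟨n₀, hn₀⟩))
    have h2 := F.le_max' _ (hshift _ (F.max'_mem ⟨n₀, hn₀⟩))
    omega
  rw [hyk, hk, zpow_zero, Equiv.Perm.one_apply]

variable {X : Type*} [MeasurableSpace X] [TopologicalSpace X] [PolishSpace X] [BorelSpace X]
  {μ : Measure X} [IsProbabilityMeasure μ]

/-- A nonatomic Borel measure on a Polish space takes arbitrarily small positive values: by outer
regularity every point has neighbourhoods of small measure. -/
lemma exists_measurableSet_pos_measure_lt [NullSingletonClass μ] {ε : ENNReal} (hε : 0 < ε) :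
    ∃ E : Set X, MeasurableSet E ∧ 0 < μ E ∧ μ E < ε := by
  let := upgradeIsCompletelyMetrizable X
  by_contra! h
  have h0 : μ univ = 0 := by
    refine measure_null_of_locally_null _ fun x _ => ?_
    obtain ⟨U, hxU, hU, hlt⟩ := ({x} : Set X).exists_isOpen_lt_of_lt (μ := μ) ε (by simpa using hε)
    refine ⟨U, mem_nhdsWithin_of_mem_nhds (hU.mem_nhds (hxU rfl)), ?_⟩
    by_contra hne
    exact absurd (h U hU.measurableSet (pos_iff_ne_zero.2 hne)) (not_le.2 hlt)
  simp at h0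

/-- An ergodic transformation of a nonatomic space is aperiodic: if `T ^ n` were the identity, the
union of `n` translates of a set of measure less than `1 / n` would be invariant. -/
lemma Ergodic.ae_pow_ne [NullSingletonClass μ] {T : Equiv.Perm X} (hT : Ergodic T μ) {n : ℕ}
    (hn : 0 < n) : ∀ᵐ x ∂μ, (T ^ n) x ≠ x := by
  have hmeas : ∀ k : ℕ, MeasurePreserving (T ^ k : Equiv.Perm X) μ μ := fun k => by
    rw [Equiv.Perm.coe_pow]
    exact hT.toMeasurePreserving.iterate k
  have hP : MeasurableSet {x | (T ^ n) x = x} :=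
    measurableSet_eq_fun (hmeas n).measurable measurable_id
  have hinv : T ⁻¹' {x | (T ^ n) x = x} = {x | (T ^ n) x = x} := by
    ext x
    have : (T ^ n) (T x) = T ((T ^ n) x) := by
      rw [← Equiv.Perm.mul_apply, ← Equiv.Perm.mul_apply, ← pow_succ, ← pow_succ']
    simp [this]
  rcases hT.toPreErgodic.ae_mem_or_ae_notMem hP hinv with h | h
  · exfalso
    obtain ⟨E, hE, hE0, hE1⟩ := exists_measurableSet_pos_measure_lt (μ := μ)
      (ε := (n : ENNReal)⁻¹) (by simp)
    set V : Set X := ⋃ k ∈ Finset.range n, (T ^ k : Equiv.Perm X) ⁻¹' E with hV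
    have hVm : MeasurableSet V :=
      Finset.measurableSet_biUnion _ fun k _ => (hmeas k).measurable hE
    have hsub : T ⁻¹' V ≤ᵐ[μ] V := by
      filter_upwards [h] with x hx hxV
      obtain ⟨k, hk, hkE⟩ := mem_iUnion₂.1 (show T x ∈ V from hxV)
      have hk' : (T ^ (k + 1)) x ∈ E := by rw [pow_succ]; exact hkE
      rcases (Nat.succ_le_of_lt (Finset.mem_range.1 hk)).lt_or_eq with h1 | h1
      · exact mem_iUnion₂.2 ⟨k + 1, Finset.mem_range.2 h1, hk'⟩
      · refine mem_iUnion₂.2 ⟨0, Finset.mem_range.2 hn, ?_⟩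
        have : k + 1 = n := h1
        rw [this] at hk'
        have hx' : (T ^ n) x = x := hx
        simpa [hx'] using hk'
    have hle : μ E ≤ μ V := by
      refine measure_mono fun x hx => mem_iUnion₂.2 ⟨0, Finset.mem_range.2 hn, by simpa using hx⟩
    have hlt : μ V < 1 := by
      calc μ V ≤ ∑ k ∈ Finset.range n, μ ((T ^ k : Equiv.Perm X) ⁻¹' E) :=
            measure_biUnion_finset_le _ _
        _ = n * μ E := by
            rw [Finset.sum_congr rfl fun k _ => (hmeas k).measure_preimage hE.nullMeasurableSet]
            simp
        _ < n * (n : ENNReal)⁻¹ :=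
            ENNReal.mul_lt_mul_right (by exact_mod_cast hn.ne') (by simp) hE1
        _ ≤ 1 := ENNReal.mul_inv_le_one _
    rcases hT.ae_empty_or_univ_of_preimage_ae_le hVm.nullMeasurableSet hsub with h0 | h1
    · rw [measure_congr h0, measure_empty] at hle
      exact absurd hle (not_le.2 hE0)
    · rw [measure_congr h1, measure_univ] at hlt
      exact lt_irrefl _ hlt
  · exact h

lemma Ergodic.ae_zpow_ne [NullSingletonClass μ] {T : Equiv.Perm X} (hT : Ergodic T μ) :
    ∀ᵐ x ∂μ, ∀ n : ℤ, n ≠ 0 → (T ^ n) x ≠ x := by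
  have h : ∀ᵐ x ∂μ, ∀ n : ℕ, 0 < n → (T ^ n) x ≠ x :=
    ae_all_iff.2 fun n => eventually_imp_distrib_left.2 fun hn => hT.ae_pow_ne hn
  filter_upwards [h] with x hx n hn hnx
  obtain ⟨m, rfl | rfl⟩ := n.eq_nat_or_neg
  · exact hx m (by omega) (by simpa using hnx)
  · refine hx m (by omega) ?_
    rw [zpow_neg, zpow_natCast, Equiv.Perm.inv_eq_iff_eq] at hnx
    exact hnx.symm

/-- Sets of positive, arbitrarily small, measure which are disjoint from their first translates. -/
lemma exists_pos_measure_disjoint_translates {T : Equiv.Perm X}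
    (hT : ∀ n : ℤ, MeasurePreserving (T ^ n : Equiv.Perm X) μ μ)
    (hfree : ∀ᵐ x ∂μ, ∀ n : ℤ, n ≠ 0 → (T ^ n) x ≠ x) (N : ℕ) :
    ∃ D : Set X, MeasurableSet D ∧ 0 < μ D ∧ (N + 1) * μ D ≤ 1 ∧
      ∀ x ∈ D, ∀ n : ℤ, n ≠ 0 → |n| ≤ N → (T ^ n) x ∉ D := by
  classical
  let K : Finset ℤ := (Finset.Icc (-N : ℤ) N).erase 0
  have hK : ∀ n : ℤ, n ∈ K ↔ n ≠ 0 ∧ |n| ≤ N := fun n => by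
    simp [K, abs_le]
  let D : Set X → Set X := fun E => E \ ⋃ n ∈ K, (T ^ n : Equiv.Perm X) ⁻¹' E
  have hDm : ∀ E ∈ countableBasis X, MeasurableSet (D E) := fun E hE =>
    have hE' := (isOpen_of_mem_countableBasis hE).measurableSet
    hE'.diff (Finset.measurableSet_biUnion _ fun n _ => (hT n).measurable hE')
  have hDdisj : ∀ E, ∀ x ∈ D E, ∀ n : ℤ, n ≠ 0 → |n| ≤ N → (T ^ n) x ∉ D E :=
    fun E x hx n hn hnN hxn => hx.2 (mem_iUnion₂.2 ⟨n, (hK n).2 ⟨hn, hnN⟩, hxn.1⟩)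
  obtain ⟨E, hE, hpos⟩ : ∃ E ∈ countableBasis X, 0 < μ (D E) := by
    by_contra! h
    have h0 : ∀ᵐ x ∂μ, ∀ E ∈ countableBasis X, x ∉ D E := by
      refine (ae_ball_iff (countable_countableBasis X)).2 fun E hE => ?_
      exact measure_eq_zero_iff_ae_notMem.1 (nonpos_iff_eq_zero.1 (h E hE))
    obtain ⟨x, hx, hxfree⟩ := (h0.and hfree).exists
    have hfin : (((fun n : ℤ => (T ^ n) x) '' (K : Set ℤ))).Finite := K.finite_toSet.image _
    obtain ⟨E, hE, hxE, hEsub⟩ := (isBasis_countableBasis X).exists_subset_of_mem_open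
      (a := x) (u := ((fun n : ℤ => (T ^ n) x) '' (K : Set ℤ))ᶜ)
      (by rintro ⟨n, hn, hnx⟩; exact hxfree n ((hK n).1 hn).1 hnx) hfin.isClosed.isOpen_compl
    refine hx E hE ⟨hxE, fun hmem => ?_⟩
    obtain ⟨n, hn, hnE⟩ := mem_iUnion₂.1 hmem
    exact hEsub hnE ⟨n, hn, rfl⟩
  refine ⟨D E, hDm E hE, hpos, ?_, hDdisj E⟩
  have hdisj : Set.Pairwise (↑(Finset.range (N + 1)) : Set ℕ)
      (Function.onFun Disjoint fun k : ℕ => (T ^ (k : ℤ) : Equiv.Perm X) ⁻¹' (D E)) := by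
    intro i hi j hj hij
    refine disjoint_left.2 fun x hxi hxj => ?_
    simp only [Finset.coe_range, mem_Iio] at hi hj
    refine hDdisj E _ hxi ((j : ℤ) - i) (by omega) (by rw [abs_le]; omega) ?_
    rw [← Equiv.Perm.mul_apply, ← zpow_add, sub_add_cancel]
    exact hxj
  have := measure_biUnion_finset hdisj (μ := μ) fun k _ => (hT k).measurable (hDm E hE)
  rw [Finset.sum_congr rfl fun (k : ℕ) _ =>
    (hT k).measure_preimage (hDm E hE).nullMeasurableSet] at this
  simp only [Finset.sum_const, Finset.card_range, nsmul_eq_mul, Nat.cast_add, Nat.cast_one] at this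
  rw [← this]
  exact prob_le_one

end Dynamics

/-! ### Orbit sums of simple functions -/

section OrbitSum

open Filter Topology

variable {𝕜 : Type*} [RCLike 𝕜] {Z : Type*} [NormedAddCommGroup Z] [NormedSpace 𝕜 Z]
  {X : Type*} [MeasurableSpace X]

/-- The sum `∑ n, h (T ^ n x) • y n` over the full orbit of `x`. When the series `∑ y n` converges
unconditionally the sum converges for every simple function `h`, as `h` is bounded. -/
noncomputable def orbitSum (T : Equiv.Perm X) (y : ℤ → Z) (h : SimpleFunc X 𝕜) (x : X) : Z :=
  ∑' n : ℤ, h ((T ^ n) x) • y n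

variable [CompleteSpace Z] {T : Equiv.Perm X} {y : ℤ → Z}

lemma summable_orbitSum (hy : Summable y) (h : SimpleFunc X 𝕜) (x : X) :
    Summable fun n : ℤ => h ((T ^ n) x) • y n := by
  obtain ⟨C, hC⟩ := h.exists_forall_norm_le
  exact hy.smul_of_norm_le fun n => hC _

lemma orbitSum_add (hy : Summable y) (h k : SimpleFunc X 𝕜) :
    orbitSum T y (h + k) = orbitSum T y h + orbitSum T y k := by
  ext x
  simp only [orbitSum, SimpleFunc.coe_add, Pi.add_apply, add_smul]
  exact (summable_orbitSum hy h x).tsum_add (summable_orbitSum hy k x)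

lemma orbitSum_sub (hy : Summable y) (h k : SimpleFunc X 𝕜) :
    orbitSum T y (h - k) = orbitSum T y h - orbitSum T y k := by
  ext x
  simp only [orbitSum, SimpleFunc.coe_sub, Pi.sub_apply, sub_smul]
  exact (summable_orbitSum hy h x).tsum_sub (summable_orbitSum hy k x)

lemma orbitSum_const_smul (hy : Summable y) (α : 𝕜) (h : SimpleFunc X 𝕜) :
    orbitSum T y (α • h) = α • orbitSum T y h := by
  ext x
  simp only [orbitSum, SimpleFunc.coe_smul, Pi.smul_apply, smul_eq_mul, mul_smul]
  exact (summable_orbitSum hy h x).tsum_const_smul α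

lemma orbitSum_apply_perm (hy : Summable y) {A : Z →L[𝕜] Z} (hA : ∀ n, A (y (n + 1)) = y n)
    (h : SimpleFunc X 𝕜) (x : X) : orbitSum T y h (T x) = A (orbitSum T y h x) := by
  rw [orbitSum, orbitSum, A.map_tsum (summable_orbitSum hy h x),
    ← (Equiv.addRight (1 : ℤ)).tsum_eq fun n => A (h ((T ^ n) x) • y n)]
  refine tsum_congr fun n => ?_
  simp only [Equiv.coe_addRight, map_smul, hA]
  rw [zpow_add, zpow_one, Equiv.Perm.mul_apply]

lemma map_orbitSum (hy : Summable y) (φ : Z →L[𝕜] 𝕜) {F : Finset ℤ} (hF : ∀ n ∉ F, φ (y n) = 0)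
    (h : SimpleFunc X 𝕜) (x : X) :
    φ (orbitSum T y h x) = ∑ n ∈ F, h ((T ^ n) x) * φ (y n) := by
  rw [orbitSum, φ.map_tsum (summable_orbitSum hy h x)]
  simp only [map_smul, smul_eq_mul]
  exact tsum_eq_sum fun n hn => by rw [hF n hn, mul_zero]

lemma finite_range_map_orbitSum (hy : Summable y) (φ : Z →L[𝕜] 𝕜) {F : Finset ℤ}
    (hF : ∀ n ∉ F, φ (y n) = 0) (h : SimpleFunc X 𝕜) :
    (range fun x => φ (orbitSum T y h x)).Finite := by
  have h1 : (range fun x => fun n : F => h ((T ^ (n : ℤ)) x)).Finite :=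
    (Set.Finite.pi' fun _ : F => h.finite_range).subset
      (range_subset_iff.2 fun x n => mem_range_self _)
  refine (h1.image fun f => ∑ n : F, f n * φ (y n)).subset (range_subset_iff.2 fun x => ?_)
  refine ⟨_, mem_range_self x, ?_⟩
  simp only
  rw [map_orbitSum hy φ hF, ← Finset.sum_coe_sort F]

variable {μ : Measure X}

/-- Uniformly bounded simple functions with small support have orbit sums which are small in
`L²`. -/
lemma exists_eLpNorm_orbitSum_le [IsProbabilityMeasure μ]
    (hT : ∀ n : ℤ, MeasurePreserving (T ^ n : Equiv.Perm X) μ μ)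
    (hy : Summable y) (M : ℝ) {ε : ℝ} (hε : 0 < ε) :
    ∃ η : ℝ, 0 < η ∧ ∀ (h : SimpleFunc X 𝕜) (B : Set X), MeasurableSet B → (∀ x, ‖h x‖ ≤ M) →
      (∀ x ∉ B, h x = 0) → μ B ≤ ENNReal.ofReal η →
      eLpNorm (orbitSum T y h) 2 μ ≤ ENNReal.ofReal ε := by
  obtain ⟨s, hs⟩ := hy.exists_finset_norm_tsum_smul_le (𝕜 := 𝕜) M (half_pos hε)
  obtain ⟨C, hC0, hC⟩ := hy.exists_norm_tsum_smul_le (𝕜 := 𝕜) M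
  set δ : ℝ := ε / (2 * (C + 1)) with hδ
  have hδ0 : 0 < δ := by positivity
  refine ⟨δ ^ 2 / (s.card + 1), by positivity, fun h B hB hM hhB hμB => ?_⟩
  -- off `B'` the orbit sum only sees the tail of the series
  set B' : Set X := ⋃ n ∈ s, (T ^ n : Equiv.Perm X) ⁻¹' B with hB'
  have hB'm : MeasurableSet B' :=
    Finset.measurableSet_biUnion _ fun n _ => (hT n).measurable hB
  have hμB' : μ B' ≤ ENNReal.ofReal (δ ^ 2) := by
    calc μ B' ≤ ∑ n ∈ s, μ ((T ^ n : Equiv.Perm X) ⁻¹' B) := measure_biUnion_finset_le _ _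
      _ = s.card * μ B := by
          rw [Finset.sum_congr rfl fun n _ => (hT n).measure_preimage hB.nullMeasurableSet]
          simp
      _ ≤ ENNReal.ofReal s.card * ENNReal.ofReal (δ ^ 2 / (s.card + 1)) := by
          rw [ENNReal.ofReal_natCast]
          gcongr
      _ ≤ ENNReal.ofReal (δ ^ 2) := by
          rw [← ENNReal.ofReal_mul (by positivity)]
          refine ENNReal.ofReal_le_ofReal ?_
          rw [mul_div_assoc', div_le_iff₀ (by positivity)]
          nlinarith [sq_nonneg δ]
  have hbound : ∀ x, ‖orbitSum T y h x‖ ≤ ‖(ε / 2 + B'.indicator (fun _ => C) x : ℝ)‖ := by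
    intro x
    by_cases hx : x ∈ B'
    · rw [indicator_of_mem hx, Real.norm_of_nonneg (by positivity)]
      exact (hC _ fun n => hM _).trans (by linarith)
    · rw [indicator_of_notMem hx, add_zero, Real.norm_of_nonneg (by positivity)]
      exact hs _ (fun n => hM _) fun n hn => hhB _ fun hnB => hx (mem_iUnion₂.2 ⟨n, hn, hnB⟩)
  calc eLpNorm (orbitSum T y h) 2 μ
      ≤ eLpNorm ((fun _ => ε / 2) + B'.indicator (fun _ => C)) 2 μ := eLpNorm_mono hbound
    _ ≤ eLpNorm (fun _ : X => ε / 2) 2 μ + eLpNorm (B'.indicator (fun _ => C)) 2 μ :=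
        eLpNorm_add_le aestronglyMeasurable_const
          ((measurable_const.indicator hB'm).aestronglyMeasurable) (by norm_num)
    _ ≤ ENNReal.ofReal (ε / 2) + ENNReal.ofReal C * ENNReal.ofReal δ := by
        refine add_le_add ?_ ((eLpNorm_indicator_const_le _ _).trans ?_)
        · refine (eLpNorm_le_of_ae_bound (C := ε / 2) (Eventually.of_forall fun x => ?_)).trans ?_
          · rw [Real.norm_of_nonneg (by positivity)]
          · simp
        · rw [Real.enorm_of_nonneg hC0]
          gcongr
          calc μ B' ^ (1 / (2 : ENNReal).toReal)
              ≤ ENNReal.ofReal (δ ^ 2) ^ (1 / (2 : ENNReal).toReal) := by gcongr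
            _ = ENNReal.ofReal δ := by
                rw [ENNReal.ofReal_pow hδ0.le, ← ENNReal.rpow_natCast, ← ENNReal.rpow_mul]
                norm_num
    _ ≤ ENNReal.ofReal ε := by
        rw [← ENNReal.ofReal_mul hC0, ← ENNReal.ofReal_add (by positivity) (by positivity)]
        refine ENNReal.ofReal_le_ofReal ?_
        have : C * δ ≤ ε / 2 := by
          rw [hδ, mul_div_assoc', div_le_div_iff₀ (by positivity) (by positivity)]
          nlinarith
        linarith

variable [MeasurableSpace Z] [BorelSpace Z] [TopologicalSpace.SeparableSpace Z]

lemma measurable_orbitSum (hT : ∀ n : ℤ, MeasurePreserving (T ^ n : Equiv.Perm X) μ μ)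
    (hy : Summable y) (h : SimpleFunc X 𝕜) : Measurable (orbitSum T y h) := by
  have : SecondCountableTopology Z := UniformSpace.secondCountable_of_separable Z
  refine measurable_of_tendsto_metrizable' (atTop : Filter (Finset ℤ))
    (f := fun s x => ∑ n ∈ s, h ((T ^ n) x) • y n) (fun s => ?_)
    (tendsto_pi_nhds.2 fun x => (summable_orbitSum hy h x).hasSum)
  exact Finset.measurable_fun_sum _ fun n _ => (h.measurable.comp (hT n).measurable).smul_const _

variable [IsProbabilityMeasure μ]

lemma memLp_orbitSum (hT : ∀ n : ℤ, MeasurePreserving (T ^ n : Equiv.Perm X) μ μ)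
    (hy : Summable y) (h : SimpleFunc X 𝕜) : MemLp (orbitSum T y h) 2 μ := by
  have : SecondCountableTopology Z := UniformSpace.secondCountable_of_separable Z
  obtain ⟨M, hM⟩ := h.exists_forall_norm_le
  obtain ⟨C, -, hC⟩ := hy.exists_norm_tsum_smul_le (𝕜 := 𝕜) M
  exact MemLp.of_bound (measurable_orbitSum hT hy h).aestronglyMeasurable C
    (Eventually.of_forall fun x => hC _ fun n => hM _)

/-- The class in `L²` of the orbit sum of a simple function. -/
noncomputable def orbitSumLp (hT : ∀ n : ℤ, MeasurePreserving (T ^ n : Equiv.Perm X) μ μ)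
    (hy : Summable y) (h : SimpleFunc X 𝕜) : Lp Z 2 μ :=
  (memLp_orbitSum hT hy h).toLp _

variable (hT : ∀ n : ℤ, MeasurePreserving (T ^ n : Equiv.Perm X) μ μ) (hy : Summable y)

lemma coeFn_orbitSumLp (h : SimpleFunc X 𝕜) : orbitSumLp hT hy h =ᵐ[μ] orbitSum T y h :=
  MemLp.coeFn_toLp _

lemma orbitSumLp_add_smul (h k : SimpleFunc X 𝕜) (α : 𝕜) :
    orbitSumLp hT hy (h + α • k) = orbitSumLp hT hy h + α • orbitSumLp hT hy k := by
  rw [orbitSumLp, orbitSumLp, orbitSumLp, ← MemLp.toLp_const_smul, ← MemLp.toLp_add]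
  refine MemLp.toLp_congr _ _ (Eventually.of_forall fun x => ?_)
  rw [orbitSum_add hy, orbitSum_const_smul hy]

lemma edist_orbitSumLp (h k : SimpleFunc X 𝕜) :
    edist (orbitSumLp hT hy h) (orbitSumLp hT hy k) = eLpNorm (orbitSum T y (h - k)) 2 μ := by
  rw [orbitSumLp, orbitSumLp, Lp.edist_toLp_toLp, orbitSum_sub hy]

lemma orbitSumLp_equivariant {A : Z →L[𝕜] Z} (hA : ∀ n, A (y (n + 1)) = y n)
    (hT₁ : MeasurePreserving T μ μ) (h : SimpleFunc X 𝕜) :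
    Lp.compMeasurePreserving T hT₁ (orbitSumLp hT hy h) = A.compLpL 2 μ (orbitSumLp hT hy h) := by
  refine Lp.ext ?_
  filter_upwards [Lp.coeFn_compMeasurePreserving (orbitSumLp hT hy h) hT₁,
    A.coeFn_compLpL (p := 2) (μ := μ) (orbitSumLp hT hy h), coeFn_orbitSumLp hT hy h,
    hT₁.quasiMeasurePreserving.ae (coeFn_orbitSumLp hT hy h)] with x h1 h2 h3 h4
  rw [h1, h2, h3, Function.comp_apply, h4, orbitSum_apply_perm hy hA]

end OrbitSum

/-! ### Two families of open conditions on `L²` functions -/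

section OpenConditions

open Filter Topology

variable {X : Type*} [MeasurableSpace X] {μ : Measure X} {Z : Type*} [NormedAddCommGroup Z]

lemma isClosed_of_ae_tendsto {S : Set (Lp Z 2 μ)}
    (hS : ∀ (f : ℕ → Lp Z 2 μ) (g : Lp Z 2 μ), (∀ n, f n ∈ S) →
      (∀ᵐ x ∂μ, Tendsto (fun n => f n x) atTop (𝓝 (g x))) → g ∈ S) : IsClosed S := by
  refine isSeqClosed_iff_isClosed.1 fun f g hf hfg => ?_
  obtain ⟨ns, -, hns⟩ := (tendstoInMeasure_of_tendsto_Lp hfg).exists_seq_tendsto_ae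
  exact hS (fun i => f (ns i)) g (fun i => hf _) hns

lemma isOpen_setOf_measure_preimage_ne_zero {U : Set Z} (hU : IsOpen U) :
    IsOpen {f : Lp Z 2 μ | μ (f ⁻¹' U) ≠ 0} := by
  rw [← isClosed_compl_iff]
  refine isClosed_of_ae_tendsto fun f g hf hfg => ?_
  simp only [mem_compl_iff, mem_ofPred_eq, not_not] at hf ⊢
  have h1 : ∀ᵐ x ∂μ, ∀ n, f n x ∉ U :=
    ae_all_iff.2 fun n => measure_eq_zero_iff_ae_notMem.1 (hf n)
  refine measure_eq_zero_iff_ae_notMem.2 ?_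
  filter_upwards [h1, hfg] with x hx hlim hxU
  obtain ⟨n, hn⟩ := (hlim.eventually (hU.mem_nhds hxU)).exists
  exact hx n hn

variable {𝕜 : Type*} [NormedField 𝕜] [MeasurableSpace 𝕜] [BorelSpace 𝕜]
  [SecondCountableTopology 𝕜]

/-- The functions `f : X → Z` in `L²` such that `s` is a continuous function of `f`, up to an error
less than `r`. The error is measured by a metric for convergence in measure, since the continuous
function need not be bounded. -/
def approxFactors (μ : Measure X) (Z : Type*) [NormedAddCommGroup Z] (s : X → 𝕜) (r : ENNReal) :
    Set (Lp Z 2 μ) :=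
  {f | ∃ κ : C(Z, 𝕜), ∫⁻ x, min 1 ‖κ (f x) - s x‖ₑ ∂μ < r}

lemma isOpen_approxFactors [IsProbabilityMeasure μ] {s : X → 𝕜} (hs : Measurable s) (r : ENNReal) :
    IsOpen (approxFactors μ Z s r) := by
  rw [← isClosed_compl_iff]
  refine isClosed_of_ae_tendsto fun f g hf hfg => ?_
  rintro ⟨κ, hκ⟩
  refine not_le.2 hκ (ge_of_tendsto' (x := atTop) ?_ fun n => not_lt.1 fun hn => hf n ⟨κ, hn⟩)
  refine tendsto_lintegral_of_dominated_convergence' (fun _ => 1) (fun n => ?_)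
    (fun n => Eventually.of_forall fun x => min_le_left _ _) (by simp) ?_
  · exact aemeasurable_const.min ((((κ.continuous.comp_stronglyMeasurable
      (Lp.stronglyMeasurable (f n))).measurable).sub hs).enorm).aemeasurable
  · filter_upwards [hfg] with x hx
    exact tendsto_const_nhds.min
      ((((κ.continuous.tendsto _).comp hx).sub_const _).enorm)

lemma exists_ae_factors {s : X → 𝕜} (hs : Measurable s) {f : Lp Z 2 μ}
    (hf : ∀ m : ℕ, f ∈ approxFactors μ Z s ((1 / 2) ^ m)) :
    ∃ G : Set X, (∀ᵐ x ∂μ, x ∈ G) ∧ ∀ x ∈ G, ∀ y ∈ G, f x = f y → s x = s y := by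
  choose κ hκ using hf
  refine ⟨{x | Tendsto (fun m => κ m (f x)) atTop (𝓝 (s x))}, ?_, fun x hx y hy hxy => ?_⟩
  · have hmeas : ∀ m, Measurable fun x => min 1 ‖κ m (f x) - s x‖ₑ := fun m =>
      measurable_const.min (((((κ m).continuous.comp_stronglyMeasurable
        (Lp.stronglyMeasurable f)).measurable).sub hs).enorm)
    have hfin : ∫⁻ x, ∑' m, min 1 ‖κ m (f x) - s x‖ₑ ∂μ ≠ ⊤ := by
      rw [lintegral_tsum fun m => (hmeas m).aemeasurable]
      refine ne_top_of_le_ne_top ?_ (ENNReal.tsum_le_tsum fun m => (hκ m).le)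
      rw [ENNReal.tsum_geometric]
      simp
    filter_upwards [ae_lt_top (Measurable.tsum hmeas) hfin] with x hx
    have h0 := ENNReal.tendsto_atTop_zero_of_tsum_ne_top hx.ne
    refine tendsto_iff_edist_tendsto_0.2 (h0.congr' ?_)
    filter_upwards [h0.eventually (gt_mem_nhds one_pos)] with m hm
    rw [edist_eq_enorm_sub]
    exact min_eq_right ((min_lt_iff.1 hm).resolve_left (lt_irrefl _)).le
  · simp only [mem_ofPred_eq, hxy] at hx hy
    exact tendsto_nhds_unique hx hy

end OpenConditions

/-! ### Density of the open conditions among orbit sums -/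

section Density

open Filter Topology TopologicalSpace

lemma exists_simpleFunc_eq_on {X 𝕜 : Type*} [MeasurableSpace X] (h : SimpleFunc X 𝕜) (a : ℤ → 𝕜)
    {B : ℤ → Set X} (hB : ∀ n, MeasurableSet (B n)) (s : Finset ℤ)
    (hdisj : ∀ m ∈ s, ∀ n ∈ s, m ≠ n → Disjoint (B m) (B n)) :
    ∃ h' : SimpleFunc X 𝕜, (∀ n ∈ s, ∀ x ∈ B n, h' x = a n) ∧
      ∀ x, (∀ n ∈ s, x ∉ B n) → h' x = h x := by
  classical
  induction s using Finset.induction_on with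
  | empty => exact ⟨h, by simp, fun x _ => rfl⟩
  | insert n₀ s hn₀ ih =>
    obtain ⟨h', h1, h2⟩ := ih fun m hm n hn =>
      hdisj m (Finset.mem_insert_of_mem hm) n (Finset.mem_insert_of_mem hn)
    refine ⟨SimpleFunc.piecewise (B n₀) (hB n₀) (SimpleFunc.const X (a n₀)) h', fun n hn x hx => ?_,
      fun x hx => ?_⟩
    · rcases Finset.mem_insert.1 hn with rfl | hn'
      · simp [hx]
      · have hne : n₀ ≠ n := fun h => hn₀ (h ▸ hn')
        have : x ∉ B n₀ := fun h0 => disjoint_left.1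
          (hdisj n₀ (Finset.mem_insert_self _ _) n hn hne) h0 hx
        simp [this, h1 n hn' x hx]
    · have : x ∉ B n₀ := hx n₀ (Finset.mem_insert_self _ _)
      simp [this, h2 x fun n hn => hx n (Finset.mem_insert_of_mem hn)]

variable {𝕜 : Type*} [RCLike 𝕜] {Z : Type*} [NormedAddCommGroup Z] [NormedSpace 𝕜 Z]
  [CompleteSpace Z] [MeasurableSpace Z] [BorelSpace Z] [SeparableSpace Z]
  {X : Type*} [MeasurableSpace X] {μ : Measure X} [IsProbabilityMeasure μ]
  {T : Equiv.Perm X} {y : ℤ → Z}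
  (hT : ∀ n : ℤ, MeasurePreserving (T ^ n : Equiv.Perm X) μ μ) (hy : Summable y)

/-- An orbit sum can be perturbed so as to take values in a given open set `U` with positive
probability: change `h` on a thin tower `⋃ n, T ^ n D` to the coefficients of a finite linear
combination of the `y n` lying in `U`. -/
lemma exists_edist_orbitSumLp_lt_measure_preimage_ne_zero [TopologicalSpace X] [PolishSpace X]
    [BorelSpace X] (hfree : ∀ᵐ x ∂μ, ∀ n : ℤ, n ≠ 0 → (T ^ n) x ≠ x)
    (hspan : (Submodule.span 𝕜 (range y)).topologicalClosure = ⊤) {U : Set Z} (hU : IsOpen U)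
    (hUne : U.Nonempty) (h : SimpleFunc X 𝕜) {ε : ℝ} (hε : 0 < ε) :
    ∃ h' : SimpleFunc X 𝕜, edist (orbitSumLp hT hy h') (orbitSumLp hT hy h) ≤ ENNReal.ofReal ε ∧
      μ (orbitSumLp hT hy h' ⁻¹' U) ≠ 0 := by
  classical
  have hdense : Dense (Submodule.span 𝕜 (range y) : Set Z) :=
    Submodule.dense_iff_topologicalClosure_eq_top.2 hspan
  obtain ⟨w, hwU, hw⟩ := hdense.inter_open_nonempty U hU hUne
  obtain ⟨a, ha⟩ := Finsupp.mem_span_range_iff_exists_finsupp.1 hw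
  obtain ⟨r, hr, hrU⟩ := Metric.nhds_basis_closedBall.mem_iff.1 (hU.mem_nhds hwU)
  obtain ⟨Mh, hMh⟩ := h.exists_forall_norm_le
  set Ma : ℝ := ∑ n ∈ a.support, ‖a n‖ with hMa
  have haM : ∀ n, ‖a n‖ ≤ Ma := by
    intro n
    by_cases hn : n ∈ a.support
    · exact Finset.single_le_sum (f := fun n => ‖a n‖) (fun _ _ => norm_nonneg _) hn
    · rw [Finsupp.notMem_support_iff.1 hn, norm_zero]
      exact Finset.sum_nonneg fun _ _ => norm_nonneg _
  have hMa0 : 0 ≤ Ma := (norm_nonneg _).trans (haM 0)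
  have hX : Nonempty X := nonempty_of_isProbabilityMeasure μ
  have hMh0 : 0 ≤ Mh := (norm_nonneg _).trans (hMh hX.some)
  set M : ℝ := 2 * (Mh + Ma) with hM
  obtain ⟨s, hs⟩ := hy.exists_finset_norm_tsum_smul_le (𝕜 := 𝕜) M hr
  obtain ⟨η, hη, hsmall⟩ := exists_eLpNorm_orbitSum_le (𝕜 := 𝕜) hT hy M hε
  -- `N` is large enough for the sets `T ^ n D`, `n ∈ s`, to be disjoint, and for their union to
  -- have measure at most `η`
  obtain ⟨N₁, hN₁⟩ := exists_nat_gt (s.card / η)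
  set N : ℕ := N₁ + 2 * ∑ n ∈ s, n.natAbs with hN
  obtain ⟨D, hD, hD0, hD1, hDdisj⟩ := exists_pos_measure_disjoint_translates hT hfree N
  let B : ℤ → Set X := fun n => (T ^ (-n) : Equiv.Perm X) ⁻¹' D
  have hBm : ∀ n, MeasurableSet (B n) := fun n => (hT (-n)).measurable hD
  have hBdisj : ∀ m ∈ s, ∀ n ∈ s, m ≠ n → Disjoint (B m) (B n) := by
    intro m hm n hn hmn
    refine disjoint_left.2 fun x hxm hxn => ?_
    have h1 := Finset.single_le_sum (f := fun n : ℤ => n.natAbs) (fun _ _ => Nat.zero_le _) hm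
    have h2 := Finset.single_le_sum (f := fun n : ℤ => n.natAbs) (fun _ _ => Nat.zero_le _) hn
    refine hDdisj _ hxm (-n + m) (by omega) (by rw [abs_le]; omega) ?_
    rw [← Equiv.Perm.mul_apply, ← zpow_add, add_neg_cancel_right]
    exact hxn
  obtain ⟨h', h1, h2⟩ := exists_simpleFunc_eq_on h (fun n => a n) hBm s hBdisj
  have hM' : ∀ x, ‖h' x‖ ≤ Mh + Ma := by
    intro x
    by_cases hx : ∃ n ∈ s, x ∈ B n
    · obtain ⟨n, hn, hxn⟩ := hx
      rw [h1 n hn x hxn]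
      linarith [haM n]
    · push Not at hx
      rw [h2 x hx]
      linarith [hMh x]
  refine ⟨h', ?_, ?_⟩
  · rw [edist_orbitSumLp]
    refine hsmall (h' - h) (⋃ n ∈ s, B n) (Finset.measurableSet_biUnion _ fun n _ => hBm n)
      (fun x => ?_) (fun x hx => ?_) ?_
    · rw [SimpleFunc.coe_sub, Pi.sub_apply]
      exact (norm_sub_le _ _).trans (by linarith [hM' x, hMh x])
    · simp only [mem_iUnion, not_exists] at hx
      rw [SimpleFunc.coe_sub, Pi.sub_apply, h2 x hx, sub_self]
    · calc μ (⋃ n ∈ s, B n) ≤ ∑ n ∈ s, μ (B n) := measure_biUnion_finset_le _ _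
        _ = s.card * μ D := by
            rw [Finset.sum_congr rfl fun n _ => (hT (-n)).measure_preimage hD.nullMeasurableSet]
            simp
        _ ≤ ENNReal.ofReal (η * (N + 1)) * μ D := by
            gcongr
            rw [← ENNReal.ofReal_natCast]
            refine ENNReal.ofReal_le_ofReal ?_
            rw [div_lt_iff₀ hη] at hN₁
            have : (N₁ : ℝ) ≤ N := by exact_mod_cast Nat.le_add_right _ _
            nlinarith
        _ = ENNReal.ofReal η * ((N + 1) * μ D) := by
            rw [ENNReal.ofReal_mul hη.le, mul_assoc, ENNReal.ofReal_add (by positivity) zero_le_one,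
              ENNReal.ofReal_natCast, ENNReal.ofReal_one]
        _ ≤ ENNReal.ofReal η := mul_le_of_le_one_right' hD1
  · have hsub : ∀ x ∈ D, orbitSum T y h' x ∈ U := by
      intro x hx
      refine hrU (mem_closedBall_iff_norm.2 ?_)
      have hw' : HasSum (fun n => a n • y n) w := by
        rw [← ha]
        exact hasSum_sum_of_ne_finset_zero fun n hn => by
          rw [Finsupp.notMem_support_iff.1 hn, zero_smul]
      have heq : orbitSum T y h' x - w = ∑' n : ℤ, (h' ((T ^ n) x) - a n) • y n := by
        simp only [sub_smul]
        exact (((summable_orbitSum hy h' x).hasSum.sub hw').tsum_eq).symm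
      rw [heq]
      refine hs _ (fun n => (norm_sub_le _ _).trans ?_) fun n hn => ?_
      · linarith [hM' ((T ^ n) x), haM n]
      · rw [h1 n hn _ ?_, sub_self]
        change (T ^ (-n)) ((T ^ n) x) ∈ D
        rwa [← Equiv.Perm.mul_apply, ← zpow_add, neg_add_cancel, zpow_zero, Equiv.Perm.one_apply]
    refine (hD0.trans_le (measure_mono_ae ?_)).ne'
    filter_upwards [coeFn_orbitSumLp hT hy h'] with x hx hxD
    change orbitSumLp hT hy h' x ∈ U
    rw [hx]
    exact hsub x hxD

/-- An orbit sum can be perturbed so that it determines, through a functional `φ` vanishing on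
`y n` for `n ∉ F`, the function `x ↦ ∑ n ∈ F, φ (y n) * 1_E (T ^ n x)`: add a small generic
multiple `α` of the orbit sum of `1_E`. Then `φ` takes finitely many values on each of the two orbit
sums, and for all but finitely many `α` the values can be read off from their combination. -/
lemma exists_dist_orbitSumLp_lt_mem_approxFactors (φ : Z →L[𝕜] 𝕜) {F : Finset ℤ}
    (hF : ∀ n ∉ F, φ (y n) = 0) {E : Set X} (hE : MeasurableSet E) (h : SimpleFunc X 𝕜) {ε : ℝ}
    (hε : 0 < ε) {r : ENNReal} (hr : 0 < r) :
    ∃ h' : SimpleFunc X 𝕜, dist (orbitSumLp hT hy h') (orbitSumLp hT hy h) < ε ∧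
      orbitSumLp hT hy h' ∈ approxFactors μ Z
        (fun x => ∑ n ∈ F, E.indicator (fun _ => φ (y n)) ((T ^ n) x)) r := by
  classical
  let k : SimpleFunc X 𝕜 :=
    SimpleFunc.piecewise E hE (SimpleFunc.const X 1) (SimpleFunc.const X 0)
  let s : X → 𝕜 := fun x => ∑ n ∈ F, E.indicator (fun _ => φ (y n)) ((T ^ n) x)
  have hk : ∀ x, φ (orbitSum T y k x) = s x := by
    intro x
    rw [map_orbitSum hy φ hF]
    refine Finset.sum_congr rfl fun n _ => ?_
    by_cases hn : (T ^ n) x ∈ E <;> simp [k, hn]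
  have hs : (range s).Finite := by
    have := finite_range_map_orbitSum (T := T) hy φ hF k
    simpa only [hk] using this
  have hg := finite_range_map_orbitSum (T := T) hy φ hF h
  set g : X → 𝕜 := fun x => φ (orbitSum T y h x)
  have hbad : (image2 (fun p q : 𝕜 => p / q) (image2 (fun p q => p - q) (range g) (range g))
      (image2 (fun p q => p - q) (range s) (range s))).Finite :=
    (hg.image2 _ hg).image2 _ (hs.image2 _ hs)
  set c : ℝ := ε / (‖orbitSumLp hT hy k‖ + 1) with hc
  have hc0 : 0 < c := by positivity
  obtain ⟨α, hαc, hα⟩ := (hbad.countable.dense_compl 𝕜).inter_open_nonempty (Metric.ball 0 c)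
    Metric.isOpen_ball ⟨0, Metric.mem_ball_self hc0⟩
  rw [mem_ball_zero_iff] at hαc
  refine ⟨h + α • k, ?_, ?_⟩
  · rw [orbitSumLp_add_smul, dist_eq_norm, add_sub_cancel_left, norm_smul]
    calc ‖α‖ * ‖orbitSumLp hT hy k‖ ≤ c * ‖orbitSumLp hT hy k‖ := by gcongr
      _ < c * (‖orbitSumLp hT hy k‖ + 1) := by gcongr; linarith
      _ = ε := by rw [hc]; field_simp
  -- the values of `s` are a function of those of `g + α * s`
  set g' : X → 𝕜 := fun x => g x + α * s x with hg'
  have hfac : Function.FactorsThrough s g' := by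
    intro x x' hxx'
    by_contra hne
    refine hα ⟨_, ⟨_, mem_range_self x', _, mem_range_self x, rfl⟩,
      _, ⟨_, mem_range_self x, _, mem_range_self x', rfl⟩, ?_⟩
    simp only [hg'] at hxx'
    simp only
    rw [div_eq_iff (sub_ne_zero.2 hne)]
    linear_combination -hxx'
  have hg'fin : (range g').Finite := by
    refine (hg.image2 (fun p q => p + α * q) hs).subset (range_subset_iff.2 fun x => ?_)
    exact ⟨_, mem_range_self x, _, mem_range_self x, rfl⟩
  let P : Polynomial 𝕜 :=
    Lagrange.interpolate hg'fin.toFinset id (Function.extend g' s 0)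
  have hP : ∀ x, P.eval (g' x) = s x := by
    intro x
    have := Lagrange.eval_interpolate_at_node (s := hg'fin.toFinset) (v := id) (i := g' x)
      (Function.extend g' s 0) (Function.injective_id.injOn)
      (hg'fin.mem_toFinset.2 (mem_range_self x))
    rw [hfac.extend_apply] at this
    exact this
  refine ⟨⟨fun z => P.eval (φ z), P.continuous.comp φ.continuous⟩, ?_⟩
  refine lt_of_eq_of_lt ?_ hr
  rw [← lintegral_zero (μ := μ)]
  refine lintegral_congr_ae ?_
  filter_upwards [coeFn_orbitSumLp hT hy (h + α • k)] with x hx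
  have hval : φ (orbitSum T y (h + α • k) x) = g' x := by
    rw [orbitSum_add hy, orbitSum_const_smul hy]
    simp [hg', g, hk]
  change min 1 ‖P.eval (φ (orbitSumLp hT hy (h + α • k) x)) - s x‖ₑ = 0
  rw [hx, hval, hP, sub_self, enorm_zero]
  simp

end Density

/-! ### The generic orbit sum -/

section Generic

open Filter Topology TopologicalSpace

/-- A form of the Baire category theorem: countably many open conditions, each of which is satisfied
by arbitrarily small perturbations of any member of a family `p`, are simultaneously satisfied by
some limit of members of the family. -/
lemma exists_mem_closure_range_of_dense {ι κ M : Type*} [Countable ι] [Nonempty κ] [MetricSpace M]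
    [CompleteSpace M] {p : κ → M} {O : ι → Set M} (hO : ∀ i, IsOpen (O i))
    (hd : ∀ i k, ∀ ε > 0, ∃ k', dist (p k') (p k) < ε ∧ p k' ∈ O i) :
    ∃ f ∈ closure (range p), ∀ i, f ∈ O i := by
  have : CompleteSpace (closure (range p)) := isClosed_closure.completeSpace_coe
  have hq : ∀ k, p k ∈ closure (range p) := fun k => subset_closure (mem_range_self k)
  have hne : Nonempty (closure (range p)) := ⟨⟨_, hq (Classical.arbitrary κ)⟩⟩
  have hdense : Dense (⋂ i, ((↑) : closure (range p) → M) ⁻¹' O i) := by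
    refine dense_iInter_of_isOpen (fun i => (hO i).preimage continuous_subtype_val) fun i => ?_
    refine Metric.dense_iff.2 fun f ε hε => ?_
    obtain ⟨_, ⟨k, rfl⟩, hk⟩ := Metric.mem_closure_iff.1 f.2 (ε / 2) (half_pos hε)
    obtain ⟨k', hk', hO'⟩ := hd i k (ε / 2) (half_pos hε)
    refine ⟨⟨p k', hq k'⟩, ?_, hO'⟩
    rw [Metric.mem_ball, Subtype.dist_eq]
    calc dist (p k') f ≤ dist (p k') (p k) + dist (p k) f := dist_triangle _ _ _
      _ < ε / 2 + ε / 2 := add_lt_add hk' (by rwa [dist_comm])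
      _ = ε := add_halves ε
  obtain ⟨f, hf⟩ := hdense.nonempty
  exact ⟨f, f.2, fun i => mem_iInter.1 hf i⟩

/-- A proper closed subspace is contained in the kernel of a nonzero continuous functional. -/
lemma exists_ne_zero_forall_mem_apply_eq_zero {𝕜 : Type*} [RCLike 𝕜] {Z : Type*}
    [NormedAddCommGroup Z] [NormedSpace 𝕜 Z] {S : Submodule 𝕜 Z} (hS : S.topologicalClosure ≠ ⊤) :
    ∃ φ : Z →L[𝕜] 𝕜, φ ≠ 0 ∧ ∀ x ∈ S, φ x = 0 := by
  have hcl : IsClosed (S.topologicalClosure : Set Z) := S.isClosed_topologicalClosure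
  obtain ⟨x, hx⟩ : ∃ x, x ∉ S.topologicalClosure := by
    by_contra! h
    exact hS (Submodule.eq_top_iff'.2 h)
  have hx' : S.topologicalClosure.mkQL x ≠ 0 := by
    simpa using hx
  obtain ⟨ψ, hψ⟩ := SeparatingDual.exists_ne_zero (R := 𝕜) hx'
  refine ⟨ψ.comp S.topologicalClosure.mkQL, fun h => hψ ?_, fun z hz => ?_⟩
  · simpa using congrArg (fun f : Z →L[𝕜] 𝕜 => f x) h
  · have : S.topologicalClosure.mkQL z = 0 := by
      simpa using S.le_topologicalClosure hz
    simp [this]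

/-- A generic `L²` limit of orbit sums is equivariant, charges every non-empty open set, and is
injective on a set of full measure. -/
lemma exists_injOn_equivariant_memLp_two {𝕜 : Type*} [RCLike 𝕜] {Z : Type*} [NormedAddCommGroup Z]
    [NormedSpace 𝕜 Z] [CompleteSpace Z] [MeasurableSpace Z] [BorelSpace Z] [SeparableSpace Z]
    {X : Type*} [MeasurableSpace X] [StandardBorelSpace X] {μ : Measure X} [IsProbabilityMeasure μ]
    [NullSingletonClass μ] {e : X ≃ᵐ X} (he : Ergodic e μ) {A : Z →L[𝕜] Z} {y : ℤ → Z}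
    (hA : ∀ n, A (y (n + 1)) = y n) (hy : Summable y)
    (hspan : (Submodule.span 𝕜 (range y)).topologicalClosure = ⊤)
    (hF : ∃ F : Finset ℤ, (Submodule.span 𝕜 (y '' {n | n ∉ F})).topologicalClosure ≠ ⊤) :
    ∃ (f : X → Z) (G : Set X), Measurable f ∧ MemLp f 2 μ ∧ (∀ᵐ x ∂μ, f (e x) = A (f x)) ∧
      (∀ U : Set Z, IsOpen U → U.Nonempty → μ (f ⁻¹' U) ≠ 0) ∧ (∀ᵐ x ∂μ, x ∈ G) ∧ InjOn f G := by
  classical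
  let := upgradeStandardBorel X
  have : SecondCountableTopology Z := UniformSpace.secondCountable_of_separable Z
  set T : Equiv.Perm X := e.toEquiv
  have hT : ∀ n : ℤ, MeasurePreserving (T ^ n : Equiv.Perm X) μ μ :=
    he.toMeasurePreserving.perm_zpow
  have hT₁ : Ergodic T μ := he
  have hfree := hT₁.ae_zpow_ne
  obtain ⟨F₀, hF₀⟩ := hF
  obtain ⟨φ, hφ0, hφ⟩ := exists_ne_zero_forall_mem_apply_eq_zero hF₀
  -- the exact support of `n ↦ φ (y n)`; it is nonempty since the `y n` span a dense subspace
  set F : Finset ℤ := F₀.filter fun n => φ (y n) ≠ 0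
  have hF : ∀ n ∉ F, φ (y n) = 0 := by
    intro n hn
    by_cases hn₀ : n ∈ F₀
    · by_contra hne
      exact hn (Finset.mem_filter.2 ⟨hn₀, hne⟩)
    · exact hφ _ (Submodule.subset_span ⟨n, hn₀, rfl⟩)
  have hFne : F.Nonempty := by
    rw [Finset.nonempty_iff_ne_empty]
    intro hempty
    have hker : Submodule.span 𝕜 (range y) ≤ φ.ker := by
      rw [Submodule.span_le]
      rintro _ ⟨n, rfl⟩
      exact hF n (by simp [hempty])
    have htop := Submodule.topologicalClosure_minimal _ hker φ.isClosed_ker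
    rw [hspan] at htop
    exact hφ0 (ContinuousLinearMap.ext fun z => htop (Submodule.mem_top (x := z)))
  let s : Set X → X → 𝕜 := fun E x => ∑ n ∈ F, E.indicator (fun _ => φ (y n)) ((T ^ n) x)
  have hE : ∀ E : countableBasis X, MeasurableSet (E : Set X) := fun E =>
    (isOpen_of_mem_countableBasis E.2).measurableSet
  have hs : ∀ E : countableBasis X, Measurable (s E) := fun E =>
    Finset.measurable_fun_sum _ fun n _ =>
      (measurable_const.indicator (hE E)).comp (hT n).measurable
  have : Countable (countableBasis X) := (countable_countableBasis X).to_subtype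
  have : Countable (countableBasis Z) := (countable_countableBasis Z).to_subtype
  let O : countableBasis Z ⊕ (countableBasis X × ℕ) → Set (Lp Z 2 μ) :=
    Sum.elim (fun U : countableBasis Z => {f | μ (f ⁻¹' (U : Set Z)) ≠ 0})
      fun q : countableBasis X × ℕ => approxFactors μ Z (s q.1) ((1 / 2) ^ q.2)
  obtain ⟨f, hfcl, hfO⟩ := exists_mem_closure_range_of_dense
    (p := fun h : SimpleFunc X 𝕜 => orbitSumLp hT hy h) (O := O) (by
      rintro (U | q)
      · exact isOpen_setOf_measure_preimage_ne_zero (isOpen_of_mem_countableBasis U.2)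
      · exact isOpen_approxFactors (hs q.1) _) (by
      rintro (U | q) h ε hε
      · obtain ⟨h', hd, hU⟩ := exists_edist_orbitSumLp_lt_measure_preimage_ne_zero hT hy hfree
          hspan (isOpen_of_mem_countableBasis U.2) (nonempty_of_mem_countableBasis U.2) h
          (half_pos hε)
        rw [edist_dist, ENNReal.ofReal_le_ofReal_iff (half_pos hε).le] at hd
        exact ⟨h', hd.trans_lt (half_lt_self hε), hU⟩
      · exact exists_dist_orbitSumLp_lt_mem_approxFactors hT hy φ hF (hE q.1) h hε
          (ENNReal.pow_pos (by norm_num) _))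
  have hequiv : Lp.compMeasurePreserving T hT₁.toMeasurePreserving f = A.compLpL 2 μ f := by
    have hclosed : IsClosed {f : Lp Z 2 μ |
        Lp.compMeasurePreserving T hT₁.toMeasurePreserving f = A.compLpL 2 μ f} :=
      isClosed_eq (Lp.isometry_compMeasurePreserving hT₁.toMeasurePreserving).continuous
        (A.compLpL 2 μ).continuous
    refine closure_minimal ?_ hclosed hfcl
    rintro _ ⟨h, rfl⟩
    exact orbitSumLp_equivariant hT hy hA hT₁.toMeasurePreserving h
  choose G hG hGs using fun E : countableBasis X =>
    exists_ae_factors (hs E) fun m => hfO (Sum.inr (E, m))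
  refine ⟨f, {x | (∀ n : ℤ, n ≠ 0 → (T ^ n) x ≠ x) ∧ ∀ E, x ∈ G E},
    (Lp.stronglyMeasurable f).measurable, Lp.memLp f, ?_, ?_, ?_, ?_⟩
  · filter_upwards [Lp.coeFn_compMeasurePreserving f hT₁.toMeasurePreserving,
      A.coeFn_compLpL (p := 2) (μ := μ) f] with x h1 h2
    rw [hequiv, h2] at h1
    exact h1.symm
  · intro U hU ⟨z, hz⟩
    obtain ⟨V, hV, -, hVU⟩ := (isBasis_countableBasis Z).exists_subset_of_mem_open hz hU
    have hVpos : μ (f ⁻¹' V) ≠ 0 := hfO (Sum.inl ⟨V, hV⟩)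
    exact fun h0 => hVpos (measure_mono_null (preimage_mono hVU) h0)
  · filter_upwards [hfree, ae_all_iff.2 hG] with x h1 h2 using ⟨h1, h2⟩
  · intro x hx x' hx' hxx'
    exact eq_of_sum_indicator_eq hFne (fun n hn => (Finset.mem_filter.1 hn).2) hx.1
      fun E hE => hGs ⟨E, hE⟩ x (hx.2 _) x' (hx'.2 _) hxx'

end Generic

/-! ### From equivariant maps to isomorphisms -/

section Isomorphism

lemma MeasurableEmbedding.exists_measurableEquiv_range {α β : Type*} [MeasurableSpace α]
    [MeasurableSpace β] {f : α → β} (hf : MeasurableEmbedding f) :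
    ∃ Φ : α ≃ᵐ range f, ∀ x, (Φ x : β) = f x := by
  refine ⟨⟨Equiv.ofInjective f hf.injective, hf.measurable.subtype_mk, fun t ht => ?_⟩,
    fun x => rfl⟩
  have h : (Equiv.ofInjective f hf.injective).symm ⁻¹' t = Subtype.val ⁻¹' (f '' t) := by
    ext ⟨_, x, rfl⟩
    simp [hf.injective.eq_iff]
  exact h ▸ measurable_subtype_coe (hf.measurableSet_image.2 ht)

/-- A measurable map which is injective on a set of full measure, and which almost everywhere
intertwines `T` and `A`, is an isomorphism of `(X, μ; T)` onto its image measure. By the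
Lusin–Souslin theorem, injective measurable images of standard Borel spaces are measurable. -/
lemma IsomorphicSystems.of_ae_injOn {X Z : Type*} [MeasurableSpace X] [StandardBorelSpace X]
    [MeasurableSpace Z] [MeasurableSpace.CountablySeparated Z] {μ : Measure X} {T : X → X}
    (hT : MeasurePreserving T μ μ) {A : Z → Z} {f : X → Z} (hf : Measurable f)
    (hfT : ∀ᵐ x ∂μ, f (T x) = A (f x)) {G : Set X} (hG : ∀ᵐ x ∂μ, x ∈ G) (hinj : InjOn f G) :
    IsomorphicSystems T μ A (μ.map f) := by
  set P : Set X := {x | f (T x) = A (f x) ∧ x ∈ G}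
  have hP : μ Pᶜ = 0 := mem_ae_iff.1 (hfT.and hG)
  set M₀ : Set X := (toMeasurable μ Pᶜ)ᶜ
  have hM₀ : MeasurableSet M₀ := (measurableSet_toMeasurable _ _).compl
  have hM₀P : M₀ ⊆ P := compl_subset_comm.1 (subset_toMeasurable μ Pᶜ)
  have hM₀μ : ∀ᵐ x ∂μ, x ∈ M₀ := by
    have : μ M₀ᶜ = 0 := by rw [compl_compl, measure_toMeasurable, hP]
    exact mem_ae_iff.2 this
  -- the points of `M₀` whose forward orbits stay in `M₀`
  set M : Set X := ⋂ n : ℕ, (T^[n]) ⁻¹' M₀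
  have hM : MeasurableSet M := MeasurableSet.iInter fun n => (hT.iterate n).measurable hM₀
  have hMμ : μ Mᶜ = 0 := by
    refine mem_ae_iff.1 ?_
    have : ∀ᵐ x ∂μ, ∀ n : ℕ, T^[n] x ∈ M₀ :=
      ae_all_iff.2 fun n => (hT.iterate n).quasiMeasurePreserving.ae hM₀μ
    filter_upwards [this] with x hx using mem_iInter.2 hx
  have hMM₀ : ∀ x ∈ M, x ∈ M₀ := fun x hx => mem_iInter.1 hx 0
  have hTM : MapsTo T M M := fun x hx => mem_iInter.2 fun n => mem_iInter.1 hx (n + 1)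
  have hfTM : ∀ x ∈ M, f (T x) = A (f x) := fun x hx => (hM₀P (hMM₀ x hx)).1
  have hinjM : Function.Injective fun x : M => f x := fun x x' hxx' =>
    Subtype.ext (hinj (hM₀P (hMM₀ _ x.2)).2 (hM₀P (hMM₀ _ x'.2)).2 hxx')
  have : StandardBorelSpace M := hM.standardBorel
  have hemb : MeasurableEmbedding fun x : M => f x :=
    (hf.comp measurable_subtype_coe).measurableEmbedding hinjM
  have hN : MeasurableSet (range fun x : M => f x) := hemb.measurableSet_range
  have hsub : ∀ x ∈ M, f x ∈ range fun x : M => f x := fun x hx => ⟨⟨x, hx⟩, rfl⟩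
  obtain ⟨Φ, hval⟩ := hemb.exists_measurableEquiv_range
  refine ⟨M, range fun x : M => f x, hM, hN, hMμ, ?_, ?_, hTM, Φ, ?_, fun x => ?_⟩
  · rw [Measure.map_apply hf hN.compl]
    exact measure_mono_null (fun x hx hxM => hx (hsub x hxM)) hMμ
  · rintro _ ⟨x, rfl⟩
    exact ⟨⟨T x, hTM x.2⟩, hfTM x x.2⟩
  · refine ⟨Φ.measurable, ?_⟩
    ext B hB
    rw [Measure.map_apply Φ.measurable hB,
      (MeasurableEmbedding.subtype_coe hM).comap_apply,
      (MeasurableEmbedding.subtype_coe hN).comap_apply,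
      Measure.map_apply hf (hN.subtype_image hB)]
    refine measure_congr ?_
    filter_upwards [mem_ae_iff.2 hMμ] with x hx
    refine propext ⟨?_, ?_⟩
    · rintro ⟨x', hx', rfl⟩
      exact ⟨_, hx', hval x'⟩
    · rintro ⟨b, hb, hbx⟩
      refine ⟨⟨x, hx⟩, ?_, rfl⟩
      have : Φ ⟨x, hx⟩ = b := Subtype.ext ((hval _).trans hbx.symm)
      change Φ ⟨x, hx⟩ ∈ B
      rwa [this]
  · rw [hval, hval]
    exact hfTM x x.2

end Isomorphism

theorem theorem1p1 {𝕜 : Type w} [RCLike 𝕜] {Z : Type v} [NormedAddCommGroup Z] [NormedSpace 𝕜 Z]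
    [CompleteSpace Z] [TopologicalSpace.SeparableSpace Z] [MeasurableSpace Z] [BorelSpace Z]
    (A : Z →L[𝕜] Z) (z : ℤ → Z) (hz : ∀ n : ℤ, A (z n) = z (n + 1))
    (ha : (Submodule.span 𝕜 (Set.range fun n : ℤ => z (-n))).topologicalClosure = ⊤)
    (hb : ∃ F : Finset ℤ,
      (Submodule.span 𝕜 ((fun n : ℤ => z (-n)) '' {n : ℤ | n ∉ F})).topologicalClosure ≠ ⊤)
    (hc : Summable fun n : ℤ => z (-n)) :
    UniversalForInvertibleErgodic.{u, v, w} A ∧ TwoUniversalForInvertibleErgodic.{u, v, w} A := by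
  -- the second moment comes for free, as the map onto `Z` is in `L²`
  suffices h : TwoUniversalForInvertibleErgodic.{u, v, w} A from
    ⟨fun X _ _ μ _ _ T hT hinv => (h X μ T hT hinv).imp fun ν hν => hν.1, h⟩
  intro X _ _ μ _ _ T hT hinv
  have : SecondCountableTopology Z := UniformSpace.secondCountable_of_separable Z
  obtain ⟨e, heT⟩ := hinv.exists_measurableEquiv
  obtain ⟨f, G, hf, hf2, hfA, hfU, hG, hinj⟩ := exists_injOn_equivariant_memLp_two
    (hT.congr_ae e.measurable heT) (A := A) (fun n => by rw [hz]; congr 1; ring) hc ha hb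
  have hfT : ∀ᵐ x ∂μ, f (T x) = A (f x) := by
    filter_upwards [heT, hfA] with x h1 h2
    rw [← h1, h2]
  refine ⟨μ.map f, ⟨Measure.isProbabilityMeasure_map hf.aemeasurable, ⟨A.continuous.measurable, ?_⟩,
    fun U hU hUne => ?_,
    IsomorphicSystems.of_ae_injOn hT.toMeasurePreserving hf hfT hG hinj⟩, ?_⟩
  · rw [Measure.map_map A.continuous.measurable hf]
    calc μ.map (A ∘ f) = μ.map (f ∘ T) :=
          Measure.map_congr (hfT.mono fun x hx => hx.symm)
      _ = μ.map f := by rw [← Measure.map_map hf hT.measurable, hT.map_eq]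
  · rw [Measure.map_apply hf hU.measurableSet]
    exact pos_iff_ne_zero.2 (hfU U hU hUne)
  · rw [lintegral_map (by fun_prop) hf]
    have := lintegral_rpow_enorm_lt_top_of_eLpNorm_lt_top (by norm_num) (by norm_num) hf2.2
    simpa using this
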